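/- **Definitions.** A *distance* on a set $X$ is a function $\mathbf d:X\times X\to[0,\infty]$ with $\mathbf d(x,y)\le\mathbf d(x,z)+\mathbf d(z,y)$ for all $x,y,z$ (neither $\mathbf d(x,x)=0$ nor symmetry is required). Put $t_+=\max(t,0)$, $\infty-\infty=0$, $\inf\emptyset=\infty$, $\sup\emptyset=0$, and $$\overline{\mathbf d}(x,z)=\sup_{y}(\mathbf d(x,y)-\mathbf d(z,y))_+,\qquad \underline{\mathbf d}(z,y)=\sup_{x}(\mathbf d(x,y)-\mathbf d(x,z))_+ .$$ The *Smyth topology* $\mathbf d^\bullet_\circ$ on $X$ is generated by the sets $\{x:\mathbf d(c,x)<r\}$ and $\{x:\mathbf d(c,x)>r\}$. Nets are indexed by nonempty sets with a transitive, not necessarily reflexive, relation $\prec$ such that any two elements $\alpha,\beta$ have some $\gamma$ with $\alpha,\beta\prec\gamma$; a net $(x_\lambda)$ is *$\mathbf d$-Cauchy* if $\lim_\gamma\sup_{\gamma\prec\delta}\mathbf d(x_\gamma,x_\delta)=0$. A set $B\subseteq X$ is a *$\mathbf d^\bullet_\circ$-basis* of $X$ if every point of $X$ is a $\mathbf d^\bullet_\circ$-limit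 of a $\mathbf d$-Cauchy net in $B$. $X$ is a *$\mathbf d^\bullet_\circ$-predomain* if $X$ is a $\mathbf d^\bullet_\circ$-basis of itself and $\overline{\mathbf d}\le\underline{\mathbf d}$, and a *$\mathbf d^\bullet_\circ$-domain* (Smyth domain) if moreover every $\mathbf d$-Cauchy net in $X$ has a $\mathbf d^\bullet_\circ$-limit in $X$. Points $x,y$ are *$\mathbf d$-equivalent* if $\mathbf d(x,z)=\mathbf d(y,z)$ and $\mathbf d(z,x)=\mathbf d(z,y)$ for all $z$. A map is an *isometry* if it preserves distances (it need be neither injective nor onto). On the formal balls $X_+=X\times[0,\infty)$ let $\mathbf d_+((x,r),(y,s))=(\mathbf d(x,y)-r+s)_+$, and for $Y,Z\subseteq X_+$ let $\mathbf d_+^{\mathcal H}(Y,Z)=\inf_{z\in Z}\sup_{y\in Y}\mathbf d_+(y,z)$. A subset $Y$ is *$\mathbf d_+$-directed* if $\inf_{y\in Y}\max_{z\in F}\mathbf d_+(z,y)=0$ for every finite $F\subseteq Y$ (the maximum over $F=\emptyset$ being $0$), and a *$\mathbf d_+$-ideal* if it is also closed in the topology generated by the balls $\{q:\overline{\mathbf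 d_+}(p,q)<r\}$. For $B\subseteq X$, with $\mathbf d$ restricted to $B$, let $\mathcal I_0^{\mathbf d}(B)$ be the set of $\mathbf d_+$-ideals $Y\subseteq B_+$ of zero aperture, i.e. with $\inf_{(b,r)\in Y}r=0$. For $x\in X$ let $x_0=\{(y,s)\in X_+:\mathbf d(y,x)\le s\}$. **Theorem.** Let $\mathbf d$ be a distance on $X$, let $X$ be a $\mathbf d^\bullet_\circ$-predomain, and let $B\subseteq X$ be a $\mathbf d^\bullet_\circ$-basis of $X$. Then: 1. $x_0\cap B_+\in\mathcal I_0^{\mathbf d}(B)$ for every $x\in X$. 2. $\mathbf d_+^{\mathcal H}$ is a distance on $\mathcal I_0^{\mathbf d}(B)$, and with it $\mathcal I_0^{\mathbf d}(B)$ is a $\mathbf d_+^{\mathcal H}{}^\bullet_\circ$-domain. 3. The map $x\mapsto x_0\cap B_+$ from $X$ to $\mathcal I_0^{\mathbf d}(B)$ is an isometry: $\mathbf d_+^{\mathcal H}(x_0\cap B_+,y_0\cap B_+)=\mathbf d(x,y)$ for all $x,y\in X$. 4. This map is onto $\mathcal I_0^{\mathbf d}(B)$ if and only if $X$ is a $\mathbf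 d^\bullet_\circ$-domain. 5. (Uniqueness of Smyth completions.) Let $\mathbf e$ be a distance on a set $Y$ that makes $Y$ an $\mathbf e^\bullet_\circ$-domain, and let $j:B\to Y$ be an isometry whose image is an $\mathbf e^\bullet_\circ$-basis of $Y$. Then there is an isometry $f:X\to Y$ such that $f(b)$ is $\mathbf e$-equivalent to $j(b)$ for all $b\in B$; any two such isometries are pointwise $\mathbf e$-equivalent; and if $X$ is a $\mathbf d^\bullet_\circ$-domain, then every point of $Y$ is $\mathbf e$-equivalent to some $f(x)$, $x\in X$. -/

import Mathlib

open Set Filter Topology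
open scoped ENNReal NNReal

universe u

namespace SmythDomains

/-- A distance: a function with values in `[0,∞]` satisfying the triangle inequality. Neither
`d x x = 0` nor symmetry is required. -/
def IsDistance {X : Type u} (d : X → X → ℝ≥0∞) : Prop :=
  ∀ x y z, d x y ≤ d x z + d z y

/-- The upper hemimetric `x, z ↦ sup_y (d x y - d z y)₊` (truncated subtraction, `∞ - ∞ = 0`). -/
noncomputable def upperHemimetric {X : Type u} (d : X → X → ℝ≥0∞) (x z : X) : ℝ≥0∞ :=
  ⨆ y, (d x y - d z y)

/-- The lower hemimetric `z, y ↦ sup_x (d x y - d x z)₊` (truncated subtraction, `∞ - ∞ = 0`). -/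
noncomputable def lowerHemimetric {X : Type u} (d : X → X → ℝ≥0∞) (z y : X) : ℝ≥0∞ :=
  ⨆ x, (d x y - d x z)

/-- The Alexandroff topology, generated by the upper balls `{x | d c x < r}`. -/
def alexandroffTopology {X : Type u} (d : X → X → ℝ≥0∞) : TopologicalSpace X :=
  TopologicalSpace.generateFrom {s | ∃ (c : X) (r : ℝ≥0∞), s = {x | d c x < r}}

/-- The lower topology, generated by the lower holes `{x | r < d c x}`. -/
def lowerHoleTopology {X : Type u} (d : X → X → ℝ≥0∞) : TopologicalSpace X :=
  TopologicalSpace.generateFrom {s | ∃ (c : X) (r : ℝ≥0∞), s = {x | r < d c x}}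

/-- The Smyth topology, generated by the upper balls and the lower holes together.
(In Mathlib's order on topologies the coarsest common refinement is the infimum.) -/
def smythTopology {X : Type u} (d : X → X → ℝ≥0∞) : TopologicalSpace X :=
  alexandroffTopology d ⊓ lowerHoleTopology d

/-- Index sets of nets: nonempty, with a transitive relation, not necessarily reflexive, for which
any two elements have a common strict upper bound. -/
structure IsNetOrder {Λ : Type u} (prec : Λ → Λ → Prop) : Prop where
  nonempty : Nonempty Λ
  trans : ∀ a b c, prec a b → prec b c → prec a c
  directed : ∀ a b, ∃ c, prec a c ∧ prec b c

/-- The filter of tails of a net. -/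
def tails {Λ : Type u} (prec : Λ → Λ → Prop) : Filter Λ :=
  ⨅ a, 𝓟 {b | prec a b}

/-- A net is `d`-Cauchy if `lim_a sup_{a ≺ b} d (x a) (x b) = 0`. -/
def IsCauchyNet {X Λ : Type u} (d : X → X → ℝ≥0∞) (prec : Λ → Λ → Prop) (x : Λ → X) : Prop :=
  Tendsto (fun a => ⨆ b, ⨆ (_ : prec a b), d (x a) (x b)) (tails prec) (𝓝 0)

/-- Convergence of a net in the Smyth topology. -/
def SmythConverges {X Λ : Type u} (d : X → X → ℝ≥0∞) (prec : Λ → Λ → Prop) (x : Λ → X)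
    (p : X) : Prop :=
  Tendsto x (tails prec) (@nhds X (smythTopology d) p)

/-- Every point is a Smyth limit of a `d`-Cauchy net in `B`. -/
def IsSmythBasis {X : Type u} (d : X → X → ℝ≥0∞) (B : Set X) : Prop :=
  ∀ p : X, ∃ (Λ : Type u) (prec : Λ → Λ → Prop) (x : Λ → X),
    IsNetOrder prec ∧ (∀ a, x a ∈ B) ∧ IsCauchyNet d prec x ∧ SmythConverges d prec x p

/-- Every point is a Smyth limit of a `d`-Cauchy net. -/
def IsSmythContinuous {X : Type u} (d : X → X → ℝ≥0∞) : Prop :=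
  ∀ p : X, ∃ (Λ : Type u) (prec : Λ → Λ → Prop) (x : Λ → X),
    IsNetOrder prec ∧ IsCauchyNet d prec x ∧ SmythConverges d prec x p

/-- Every `d`-Cauchy net has a Smyth limit. -/
def IsSmythComplete {X : Type u} (d : X → X → ℝ≥0∞) : Prop :=
  ∀ (Λ : Type u) (prec : Λ → Λ → Prop) (x : Λ → X),
    IsNetOrder prec → IsCauchyNet d prec x → ∃ p, SmythConverges d prec x p

/-- Smyth predomains. -/
def IsSmythPredomain {X : Type u} (d : X → X → ℝ≥0∞) : Prop :=
  IsSmythContinuous d ∧ ∀ x y, upperHemimetric d x y ≤ lowerHemimetric d x y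

/-- Smyth domains. -/
def IsSmythDomain {X : Type u} (d : X → X → ℝ≥0∞) : Prop :=
  IsSmythComplete d ∧ IsSmythPredomain d

/-- `d`-directed subsets (necessarily nonempty, by the case `F = ∅`, since `inf ∅ = ∞`). -/
def IsDirectedSubset {X : Type u} (d : X → X → ℝ≥0∞) (Y : Set X) : Prop :=
  ∀ F : Finset X, (F : Set X) ⊆ Y → ⨅ y ∈ Y, ⨆ z ∈ F, d z y = 0

/-- `d`-ideals: `d`-directed subsets that are closed in the Alexandroff topology of the upper
hemimetric. -/
def IsDistIdeal {X : Type u} (d : X → X → ℝ≥0∞) (Y : Set X) : Prop :=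
  IsDirectedSubset d Y ∧ IsClosed[alexandroffTopology (upperHemimetric d)] Y

/-- The distance `((x,r),(y,s)) ↦ (d x y - r + s)₊` on the formal balls `X₊ = X × [0,∞)`. -/
noncomputable def formalBallDist {X : Type u} (d : X → X → ℝ≥0∞) (p q : X × ℝ≥0) : ℝ≥0∞ :=
  (d p.1 q.1 + (q.2 : ℝ≥0∞)) - (p.2 : ℝ≥0∞)

/-- The reverse Hausdorff distance `inf_{z ∈ Z} sup_{y ∈ Y} d y z`. -/
noncomputable def reverseHausdorff {X : Type u} (d : X → X → ℝ≥0∞) (Y Z : Set X) : ℝ≥0∞ :=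
  ⨅ z ∈ Z, ⨆ y ∈ Y, d y z

/-- The aperture of a set of formal balls: the infimum of the radii. -/
noncomputable def aperture {X : Type u} (Y : Set (X × ℝ≥0)) : ℝ≥0∞ :=
  ⨅ p ∈ Y, (p.2 : ℝ≥0∞)

/-- The ideals of formal balls with zero aperture. -/
def zeroApertureIdeals {X : Type u} (d : X → X → ℝ≥0∞) : Set (Set (X × ℝ≥0)) :=
  {Y | IsDistIdeal (formalBallDist d) Y ∧ aperture Y = 0}

/-- The reverse Hausdorff distance of the formal ball distance, on zero-aperture ideals. -/
noncomputable def idealDist {X : Type u} (d : X → X → ℝ≥0∞) (Y Z : zeroApertureIdeals d) :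
    ℝ≥0∞ :=
  reverseHausdorff (formalBallDist d) Y.1 Z.1

/-- The restriction of a distance to a subset. -/
def restrictDist {X : Type u} (d : X → X → ℝ≥0∞) (B : Set X) : B → B → ℝ≥0∞ :=
  fun b c => d b c

/-- `x₀`: the formal balls at zero distance below `(x, 0)`. -/
def pointBalls {X : Type u} (d : X → X → ℝ≥0∞) (x : X) : Set (X × ℝ≥0) :=
  {p | formalBallDist d p (x, 0) = 0}

/-- `x₀ ∩ B₊`, as a set of formal balls of `B`. -/
def pointBallsIn {X : Type u} (d : X → X → ℝ≥0∞) (B : Set X) (x : X) : Set (B × ℝ≥0) :=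
  {p | ((p.1 : X), p.2) ∈ pointBalls d x}

/-- `d`-equivalent points: they have the same distances to and from every point. -/
def DistEquiv {X : Type u} (d : X → X → ℝ≥0∞) (x y : X) : Prop :=
  ∀ z, d x z = d y z ∧ d z x = d z y

end SmythDomains

/-! A zero-aperture ideal `Y` of formal balls over `A` encodes the distance function `φ b = inf {t |
(b, t) ∈ Y}` towards an ideal point; a point `x` yields `φ = d(·, x)`. Everything is proved for an
isometry `j : A → X` with basis image (`IsDenseIsometry`), so that one argument serves both the
inclusion `B → X` and the map `B → Y` of the uniqueness claim.

The ideals are complete by the triangle inequality alone: a Cauchy net of ideals converges to its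
lower limit (`isSmythComplete_idealDist`). The condition `d̄ ≤ d̲` enters only in
`dist_add_le_of_forall`, where distances from `A` to `x` and `c` control distances out of `x`. This
makes `toIdeal` an isometry (`idealDist_toIdeal`) and passes the condition on to the ideals.

If `X` is complete, an ideal comes from the limit of a Cauchy net in `A` with limit distances `φ`.
Two completions then embed in the same ideals, and points with equal ideals are equivalent. -/

namespace SmythDomains

/-! ### Nets, Smyth convergence and bases in terms of finite approximations. -/

section Preliminaries

lemma coe_half_add_half (ε : ℝ≥0) : ((ε / 2 : ℝ≥0) : ℝ≥0∞) + (ε / 2 : ℝ≥0) = ε := by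
  rw [← ENNReal.coe_add, add_halves]

lemma biInf_eq_zero_iff {ι : Type u} {S : Set ι} {f : ι → ℝ≥0∞} :
    ⨅ y ∈ S, f y = 0 ↔ ∀ ε : ℝ≥0, 0 < ε → ∃ y ∈ S, f y ≤ ε := by
  constructor
  · intro h ε hε
    have : ⨅ y ∈ S, f y < ε := by rw [h]; exact_mod_cast hε
    obtain ⟨y, hy⟩ := iInf_lt_iff.1 this
    obtain ⟨hyS, hy⟩ := iInf_lt_iff.1 hy
    exact ⟨y, hyS, hy.le⟩
  · intro h
    refine le_antisymm (ENNReal.le_of_forall_pos_le_add fun ε hε _ => ?_) zero_le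
    obtain ⟨y, hy, hle⟩ := h ε hε
    exact (iInf₂_le y hy).trans (by simpa using hle)

lemma tendsto_of_forall_le_add {ι : Type u} {l : Filter ι} {f : ι → ℝ≥0∞} {r : ℝ≥0∞}
    (hle : ∀ ε : ℝ≥0, 0 < ε → ∀ᶠ i in l, f i ≤ r + ε)
    (hge : ∀ ε : ℝ≥0, 0 < ε → ∀ᶠ i in l, r ≤ f i + ε) : Tendsto f l (𝓝 r) := by
  refine tendsto_order.2 ⟨fun a ha => ?_, fun a ha => ?_⟩
  · obtain ⟨ε, hε, h⟩ := ENNReal.lt_iff_exists_add_pos_lt.1 ha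
    filter_upwards [hge ε hε] with i hi
    by_contra! hlt
    exact absurd (h.trans_le hi) (not_lt.2 (by gcongr))
  · obtain ⟨ε, hε, h⟩ := ENNReal.lt_iff_exists_add_pos_lt.1 ha
    filter_upwards [hle ε hε] with i hi
    exact hi.trans_lt h

lemma eventually_le_add {ι : Type u} {l : Filter ι} {f : ι → ℝ≥0∞} {r : ℝ≥0∞}
    (h : Tendsto f l (𝓝 r)) {ε : ℝ≥0} (hε : 0 < ε) : ∀ᶠ i in l, f i ≤ r + ε := by
  rcases eq_or_ne r ⊤ with rfl | hr
  · simp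
  · have : r < r + ε := ENNReal.lt_add_right hr (by exact_mod_cast hε.ne')
    filter_upwards [(tendsto_order.1 h).2 _ this] with i hi using hi.le

variable {Λ X : Type u} {prec : Λ → Λ → Prop} {d : X → X → ℝ≥0∞} {x : Λ → X} {p : X}

lemma IsNetOrder.eventually_iff (hΛ : IsNetOrder prec) {P : Λ → Prop} :
    (∀ᶠ a in tails prec, P a) ↔ ∃ a, ∀ b, prec a b → P b := by
  have : Nonempty Λ := hΛ.nonempty
  have hb : (tails prec).HasBasis (fun _ => True) (fun a => {b | prec a b}) := by
    refine hasBasis_iInf_principal fun a b => ?_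
    obtain ⟨c, hac, hbc⟩ := hΛ.directed a b
    exact ⟨c, fun e he => hΛ.trans _ _ _ hac he, fun e he => hΛ.trans _ _ _ hbc he⟩
  rw [hb.eventually_iff]
  simp

lemma IsNetOrder.neBot (hΛ : IsNetOrder prec) : (tails prec).NeBot := by
  refine ⟨fun h => ?_⟩
  obtain ⟨a, ha⟩ := (hΛ.eventually_iff (P := fun _ => False)).1 (by simp [h])
  obtain ⟨c, hc, -⟩ := hΛ.directed a a
  exact ha c hc

lemma IsNetOrder.eventually_prec (hΛ : IsNetOrder prec) (a : Λ) :
    ∀ᶠ b in tails prec, prec a b :=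
  hΛ.eventually_iff.2 ⟨a, fun _ h => h⟩

lemma isCauchyNet_iff : IsCauchyNet d prec x ↔
    ∀ ε : ℝ≥0, 0 < ε → ∀ᶠ a in tails prec, ∀ b, prec a b → d (x a) (x b) ≤ ε := by
  unfold IsCauchyNet
  rw [ENNReal.tendsto_nhds_zero]
  simp only [iSup_le_iff]
  constructor
  · exact fun h ε hε => h ε (by exact_mod_cast hε)
  · intro h ε hε
    obtain ⟨δ, hδ, hlt⟩ := ENNReal.lt_iff_exists_nnreal_btwn.1 hε
    filter_upwards [h δ (by exact_mod_cast hδ)] with a ha b hab using (ha b hab).trans hlt.le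

/-- The generating sets are the preimages of open rays under the maps `d c ·`. -/
lemma smythConverges_iff :
    SmythConverges d prec x p ↔ ∀ c, Tendsto (fun a => d c (x a)) (tails prec) (𝓝 (d c p)) := by
  unfold SmythConverges smythTopology alexandroffTopology lowerHoleTopology
  rw [nhds_inf, tendsto_inf, TopologicalSpace.tendsto_nhds_generateFrom_iff,
    TopologicalSpace.tendsto_nhds_generateFrom_iff]
  constructor
  · rintro ⟨h₁, h₂⟩ c
    exact tendsto_order.2 ⟨fun r hr => h₂ _ ⟨c, r, rfl⟩ hr, fun r hr => h₁ _ ⟨c, r, rfl⟩ hr⟩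
  · refine fun h => ⟨?_, ?_⟩
    · rintro _ ⟨c, r, rfl⟩ hp
      exact (tendsto_order.1 (h c)).2 r hp
    · rintro _ ⟨c, r, rfl⟩ hp
      exact (tendsto_order.1 (h c)).1 r hp

/-- The missing lower bounds follow from `d c p ≤ d c (x a) + d (x a) p`. -/
lemma smythConverges_of_le (hd : IsDistance d)
    (h₀ : ∀ ε : ℝ≥0, 0 < ε → ∀ᶠ a in tails prec, d (x a) p ≤ ε)
    (h : ∀ c, ∀ ε : ℝ≥0, 0 < ε → ∀ᶠ a in tails prec, d c (x a) ≤ d c p + ε) :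
    SmythConverges d prec x p := by
  refine smythConverges_iff.2 fun c => tendsto_of_forall_le_add (h c) fun ε hε => ?_
  filter_upwards [h₀ ε hε] with a ha
  exact (hd c p (x a)).trans (by gcongr)

/-- A Cauchy net with prescribed limit distances, obtained by ordering its finite
approximations. -/
lemma exists_cauchyNet (S : Set X) (φ : X → ℝ≥0∞)
    (h : ∀ (F : Finset X) (ε : ℝ≥0), 0 < ε → ∃ b ∈ S, φ b ≤ ε ∧ ∀ c ∈ F, d c b ≤ φ c + ε) :
    ∃ (Λ : Type u) (prec : Λ → Λ → Prop) (x : Λ → X), IsNetOrder prec ∧ (∀ a, x a ∈ S) ∧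
      IsCauchyNet d prec x ∧ (∀ ε : ℝ≥0, 0 < ε → ∀ᶠ a in tails prec, φ (x a) ≤ ε) ∧
      ∀ c, ∀ ε : ℝ≥0, 0 < ε → ∀ᶠ a in tails prec, d c (x a) ≤ φ c + ε := by
  classical
  let Λ : Type u := {q : X × Finset X × ℝ≥0 //
    q.1 ∈ S ∧ 0 < q.2.2 ∧ φ q.1 ≤ q.2.2 ∧ ∀ c ∈ q.2.1, d c q.1 ≤ φ c + q.2.2}
  -- The earlier point is a constraint on the later one, so `d (x a) (x b) ≤ φ (x a) + ε_b`, which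
  -- makes the net Cauchy.
  let prec : Λ → Λ → Prop := fun a b =>
    b.1.2.2 ≤ a.1.2.2 ∧ insert a.1.1 a.1.2.1 ⊆ b.1.2.1
  have hex : ∀ (F : Finset X) (ε : ℝ≥0), 0 < ε → ∃ a : Λ, a.1.2 = (F, ε) := fun F ε hε => by
    obtain ⟨b, hb, h₁, h₂⟩ := h F ε hε
    exact ⟨⟨(b, F, ε), hb, hε, h₁, h₂⟩, rfl⟩
  have hΛ : IsNetOrder prec := by
    refine ⟨?_, ?_, ?_⟩
    · obtain ⟨a, -⟩ := hex ∅ 1 one_pos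
      exact ⟨a⟩
    · rintro a b c ⟨h₁, h₂⟩ ⟨h₃, h₄⟩
      exact ⟨h₃.trans h₁, h₂.trans ((Finset.subset_insert _ _).trans h₄)⟩
    · intro a b
      obtain ⟨c, hc⟩ := hex (insert a.1.1 a.1.2.1 ∪ insert b.1.1 b.1.2.1)
        (min a.1.2.2 b.1.2.2) (lt_min a.2.2.1 b.2.2.1)
      refine ⟨c, ⟨?_, ?_⟩, ⟨?_, ?_⟩⟩ <;> rw [hc]
      exacts [min_le_left _ _, Finset.subset_union_left, min_le_right _ _,
        Finset.subset_union_right]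
  refine ⟨Λ, prec, fun a => a.1.1, hΛ, fun a => a.2.1, ?_, ?_, ?_⟩
  · refine isCauchyNet_iff.2 fun ε hε => ?_
    obtain ⟨a, ha⟩ := hex ∅ (ε / 2) (half_pos hε)
    filter_upwards [hΛ.eventually_prec a] with b hb c hc
    have h₁ : b.1.2.2 ≤ ε / 2 := by simpa [ha] using hb.1
    calc d b.1.1 c.1.1 ≤ φ b.1.1 + c.1.2.2 := c.2.2.2.2 _ (hc.2 (Finset.mem_insert_self _ _))
      _ ≤ (b.1.2.2 : ℝ≥0∞) + c.1.2.2 := by gcongr; exact b.2.2.2.1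
      _ ≤ ((ε / 2 : ℝ≥0) : ℝ≥0∞) + (ε / 2 : ℝ≥0) := by
        gcongr
        exact hc.1.trans h₁
      _ = ε := by rw [coe_half_add_half]
  · intro ε hε
    obtain ⟨a, ha⟩ := hex ∅ ε hε
    filter_upwards [hΛ.eventually_prec a] with b hb
    refine b.2.2.2.1.trans ?_
    simpa [ha] using hb.1
  · intro c ε hε
    obtain ⟨a, ha⟩ := hex {c} ε hε
    filter_upwards [hΛ.eventually_prec a] with b hb
    have h₁ : b.1.2.2 ≤ ε := by simpa [ha] using hb.1
    refine (b.2.2.2.2 c (hb.2 (by simp [ha]))).trans ?_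
    gcongr

lemma eventually_dist_limit_le (hΛ : IsNetOrder prec) (hx : IsCauchyNet d prec x)
    (hp : SmythConverges d prec x p) {ε : ℝ≥0} (hε : 0 < ε) :
    ∀ᶠ a in tails prec, d (x a) p ≤ ε := by
  have := hΛ.neBot
  filter_upwards [isCauchyNet_iff.1 hx ε hε] with a ha
  refine le_of_tendsto (smythConverges_iff.1 hp (x a)) ?_
  filter_upwards [hΛ.eventually_prec a] with b hb using ha b hb

lemma IsSmythBasis.approx {B : Set X} (hB : IsSmythBasis d B) (p : X) (F : Finset X) {ε : ℝ≥0}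
    (hε : 0 < ε) : ∃ b ∈ B, d b p ≤ ε ∧ ∀ c ∈ F, d c b ≤ d c p + ε := by
  obtain ⟨Λ, prec, x, hΛ, hxB, hx, hp⟩ := hB p
  have := hΛ.neBot
  have hF : ∀ᶠ a in tails prec, ∀ c ∈ F, d c (x a) ≤ d c p + ε :=
    (Filter.eventually_all_finset F).2 fun c _ =>
      eventually_le_add (smythConverges_iff.1 hp c) hε
  obtain ⟨a, h₁, h₂⟩ := ((eventually_dist_limit_le hΛ hx hp hε).and hF).exists
  exact ⟨x a, hxB a, h₁, h₂⟩

lemma IsSmythBasis.of_approx (hd : IsDistance d) {B : Set X}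
    (h : ∀ (p : X) (F : Finset X) (ε : ℝ≥0), 0 < ε →
      ∃ b ∈ B, d b p ≤ ε ∧ ∀ c ∈ F, d c b ≤ d c p + ε) : IsSmythBasis d B := by
  intro p
  obtain ⟨Λ, prec, x, hΛ, hxB, hx, h₀, h₁⟩ := exists_cauchyNet B (fun c => d c p) (h p)
  exact ⟨Λ, prec, x, hΛ, hxB, hx, smythConverges_of_le hd h₀ h₁⟩

lemma IsSmythBasis.isSmythContinuous {B : Set X} (hB : IsSmythBasis d B) :
    IsSmythContinuous d := by
  intro p
  obtain ⟨Λ, prec, x, hΛ, -, hx, hp⟩ := hB p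
  exact ⟨Λ, prec, x, hΛ, hx, hp⟩

end Preliminaries

/-! ### Ideals of formal balls and their distance. -/

section Ideals

variable {X : Type u} {d : X → X → ℝ≥0∞}

lemma dist_le_upperHemimetric_add (x y z : X) : d x y ≤ upperHemimetric d x z + d z y :=
  tsub_le_iff_right.1 (le_iSup (fun y => d x y - d z y) y)

lemma dist_le_add_lowerHemimetric (x y z : X) : d x y ≤ lowerHemimetric d z y + d x z :=
  tsub_le_iff_right.1 (le_iSup (fun x => d x y - d x z) x)

lemma isDirectedSubset_iff {Y : Set X} : IsDirectedSubset d Y ↔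
    ∀ F : Finset X, (F : Set X) ⊆ Y → ∀ ε : ℝ≥0, 0 < ε → ∃ y ∈ Y, ∀ z ∈ F, d z y ≤ ε := by
  simp only [IsDirectedSubset, biInf_eq_zero_iff, iSup_le_iff]

/-- A set is closed for the upper hemimetric as soon as it contains the points at zero upper
distance from it, and conversely. -/
lemma isClosed_upperHemimetric_iff {Y : Set X} :
    IsClosed[alexandroffTopology (upperHemimetric d)] Y ↔
      ∀ q, (∀ ε : ℝ≥0, 0 < ε → ∃ y ∈ Y, upperHemimetric d q y ≤ ε) → q ∈ Y := by
  have hself : ∀ q, upperHemimetric d q q = 0 := fun q => by simp [upperHemimetric]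
  have htri : ∀ p q r, upperHemimetric d p r ≤ upperHemimetric d p q + upperHemimetric d q r := by
    intro p q r
    refine iSup_le fun y => tsub_le_iff_right.2 ?_
    calc d p y ≤ upperHemimetric d p q + d q y := dist_le_upperHemimetric_add _ _ _
      _ ≤ upperHemimetric d p q + (upperHemimetric d q r + d r y) := by
        gcongr; exact dist_le_upperHemimetric_add _ _ _
      _ = _ := by ring
  let _ : TopologicalSpace X := alexandroffTopology (upperHemimetric d)
  -- By `hself` and `htri`, balls centred at `q` form a neighbourhood base at `q`.
  have hnhds : ∀ q, ∀ s : Set X, IsOpen s → q ∈ s →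
      ∃ ε : ℝ≥0, 0 < ε ∧ ∀ y, upperHemimetric d q y ≤ ε → y ∈ s := by
    intro q s hs
    induction hs with
    | basic s hs =>
      obtain ⟨c, r, rfl⟩ := hs
      intro hq
      obtain ⟨ε, hε, hlt⟩ := ENNReal.lt_iff_exists_add_pos_lt.1 
        (show upperHemimetric d c q < r from hq)
      refine ⟨ε, hε, fun y hy => ?_⟩
      exact ((htri c q y).trans (by gcongr)).trans_lt hlt
    | univ => exact fun _ => ⟨1, one_pos, fun _ _ => mem_univ _⟩
    | inter s t _ _ hs ht =>
      rintro ⟨h₁, h₂⟩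
      obtain ⟨ε, hε, h⟩ := hs h₁
      obtain ⟨δ, hδ, h'⟩ := ht h₂
      refine ⟨min ε δ, lt_min hε hδ, fun y hy => ⟨h y (hy.trans ?_), h' y (hy.trans ?_)⟩⟩
      · exact_mod_cast min_le_left _ _
      · exact_mod_cast min_le_right _ _
    | sUnion S _ ih =>
      rintro ⟨t, htS, hqt⟩
      obtain ⟨ε, hε, h⟩ := ih t htS hqt
      exact ⟨ε, hε, fun y hy => ⟨t, htS, h y hy⟩⟩
  constructor
  · intro hY q hq
    by_contra hqY
    obtain ⟨ε, hε, h⟩ := hnhds q Yᶜ hY.isOpen_compl hqY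
    obtain ⟨y, hy, hle⟩ := hq ε hε
    exact h y hle hy
  · intro h
    refine ⟨isOpen_iff_forall_mem_open.2 fun q hq => ?_⟩
    have : ∃ ε : ℝ≥0, 0 < ε ∧ ∀ y ∈ Y, ε < upperHemimetric d q y := by
      by_contra! hcon
      exact hq (h q hcon)
    obtain ⟨ε, hε, hlt⟩ := this
    refine ⟨{y | upperHemimetric d q y < ε}, fun y hy hyY => ?_,
      TopologicalSpace.isOpen_generateFrom_of_mem ⟨q, ε, rfl⟩, ?_⟩
    · exact lt_asymm hy (hlt y hyY)
    · simpa [hself] using hε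

/-- For a directed set `d̄` may be replaced by `d` in the closedness condition: `d̄ ≤ d` by the
triangle inequality, and conversely directedness moves `y` to some `z ∈ Y` with `d y z` small, which
is needed as `d y y` may be positive. -/
lemma isDistIdeal_iff (hd : IsDistance d) {Y : Set X} : IsDistIdeal d Y ↔
    (∀ F : Finset X, (F : Set X) ⊆ Y → ∀ ε : ℝ≥0, 0 < ε → ∃ y ∈ Y, ∀ z ∈ F, d z y ≤ ε) ∧
      ∀ q, (∀ ε : ℝ≥0, 0 < ε → ∃ y ∈ Y, d q y ≤ ε) → q ∈ Y := by
  unfold IsDistIdeal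
  rw [isDirectedSubset_iff, isClosed_upperHemimetric_iff]
  refine and_congr_right fun hdir => forall_congr' fun q => imp_congr_left ?_
  constructor
  · intro h ε hε
    obtain ⟨y, hy, hle⟩ := h (ε / 2) (half_pos hε)
    obtain ⟨z, hz, hyz⟩ := hdir {y} (by simpa using hy) (ε / 2) (half_pos hε)
    refine ⟨z, hz, ?_⟩
    calc d q z ≤ upperHemimetric d q y + d y z := dist_le_upperHemimetric_add _ _ _
      _ ≤ ((ε / 2 : ℝ≥0) : ℝ≥0∞) + (ε / 2 : ℝ≥0) := by
        gcongr; exact hyz y (by simp)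
      _ = ε := by rw [coe_half_add_half]
  · intro h ε hε
    obtain ⟨y, hy, hle⟩ := h ε hε
    refine ⟨y, hy, le_trans (iSup_le fun w => tsub_le_iff_right.2 (hd q w y)) hle⟩

lemma formalBallDist_le_iff {p q : X × ℝ≥0} {M : ℝ≥0∞} :
    formalBallDist d p q ≤ M ↔ d p.1 q.1 + q.2 ≤ M + p.2 :=
  tsub_le_iff_right

lemma isDistance_formalBallDist (hd : IsDistance d) : IsDistance (formalBallDist d) := by
  intro p q r
  have h₁ := formalBallDist_le_iff.1 (le_refl (formalBallDist d p r))
  have h₂ := formalBallDist_le_iff.1 (le_refl (formalBallDist d r q))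
  rw [formalBallDist_le_iff]
  calc d p.1 q.1 + q.2 ≤ (d p.1 r.1 + d r.1 q.1) + q.2 := by gcongr; exact hd _ _ _
    _ = d p.1 r.1 + (d r.1 q.1 + q.2) := by ring
    _ ≤ d p.1 r.1 + (formalBallDist d r q + r.2) := add_le_add_right h₂ _
    _ = (d p.1 r.1 + r.2) + formalBallDist d r q := by ring
    _ ≤ (formalBallDist d p r + p.2) + formalBallDist d r q := add_le_add_left h₁ _
    _ = _ := by ring

lemma mem_zeroApertureIdeals_iff (hd : IsDistance d) {Y : Set (X × ℝ≥0)} :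
    Y ∈ zeroApertureIdeals d ↔
      (∀ F : Finset (X × ℝ≥0), (F : Set (X × ℝ≥0)) ⊆ Y → ∀ ε : ℝ≥0, 0 < ε →
        ∃ y ∈ Y, ∀ z ∈ F, d z.1 y.1 + y.2 ≤ ε + z.2) ∧
      (∀ b t, (∀ ε : ℝ≥0, 0 < ε → ∃ y ∈ Y, d b y.1 + y.2 ≤ ε + (t : ℝ≥0)) → (b, t) ∈ Y) ∧
      ∀ ε : ℝ≥0, 0 < ε → ∃ y ∈ Y, y.2 ≤ ε := by
  unfold zeroApertureIdeals aperture
  rw [mem_ofPred_eq, isDistIdeal_iff (isDistance_formalBallDist hd), biInf_eq_zero_iff, and_assoc]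
  simp only [formalBallDist_le_iff, Prod.forall, ENNReal.coe_le_coe]

/-- An upper bound of a ball of small radius again has small radius, so adding such a ball to `F`
controls `y.2`. -/
lemma exists_mem_ideal_le (hd : IsDistance d) (Y : zeroApertureIdeals d)
    (F : Finset (X × ℝ≥0)) (hF : (F : Set (X × ℝ≥0)) ⊆ Y.1) {ε : ℝ≥0} (hε : 0 < ε) :
    ∃ y ∈ Y.1, y.2 ≤ ε ∧ ∀ z ∈ F, d z.1 y.1 + y.2 ≤ ε + z.2 := by
  classical
  obtain ⟨h₁, -, h₃⟩ := (mem_zeroApertureIdeals_iff hd).1 Y.2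
  obtain ⟨p, hp, hpε⟩ := h₃ (ε / 2) (half_pos hε)
  obtain ⟨y, hy, hle⟩ := h₁ (insert p F) (by simp [insert_subset_iff, hp, hF]) (ε / 2) (half_pos hε)
  refine ⟨y, hy, ?_, fun z hz => (hle z (Finset.mem_insert_of_mem hz)).trans ?_⟩
  · have : (y.2 : ℝ≥0∞) ≤ ε := calc
      (y.2 : ℝ≥0∞) ≤ d p.1 y.1 + y.2 := le_add_self
      _ ≤ ((ε / 2 : ℝ≥0) : ℝ≥0∞) + p.2 := hle p (Finset.mem_insert_self _ _)
      _ ≤ ((ε / 2 : ℝ≥0) : ℝ≥0∞) + (ε / 2 : ℝ≥0) := by gcongr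
      _ = ε := by rw [coe_half_add_half]
    exact_mod_cast this
  · gcongr
    exact half_le_self (zero_le)

lemma mem_ideal_of_forall (hd : IsDistance d) (Y : zeroApertureIdeals d) {b : X} {t : ℝ≥0}
    (h : ∀ ε : ℝ≥0, 0 < ε → ∃ y ∈ Y.1, d b y.1 + y.2 ≤ ε + t) : (b, t) ∈ Y.1 :=
  ((mem_zeroApertureIdeals_iff hd).1 Y.2).2.1 b t h

lemma mem_ideal_of_le (hd : IsDistance d) (Y : zeroApertureIdeals d) {b : X} {t : ℝ≥0}
    {y : X × ℝ≥0} (hy : y ∈ Y.1) (h : d b y.1 + y.2 ≤ t) : (b, t) ∈ Y.1 :=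
  mem_ideal_of_forall hd Y fun _ _ => ⟨y, hy, h.trans le_add_self⟩

/-- Membership is upward closed in the radius. -/
lemma mem_ideal_mono (hd : IsDistance d) (Y : zeroApertureIdeals d) {b : X} {s t : ℝ≥0}
    (h : (b, s) ∈ Y.1) (hst : s ≤ t) : (b, t) ∈ Y.1 := by
  refine mem_ideal_of_forall hd Y fun ε hε => ?_
  obtain ⟨y, hy, -, hle⟩ := exists_mem_ideal_le hd Y {(b, s)} (by simpa using h) hε
  refine ⟨y, hy, (hle _ (Finset.mem_singleton_self _)).trans ?_⟩
  gcongr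

lemma idealDist_le {Y Z : zeroApertureIdeals d} {M : ℝ≥0∞} {p : X × ℝ≥0} (hp : p ∈ Z.1)
    (h : ∀ q ∈ Y.1, d q.1 p.1 + p.2 ≤ M + q.2) : idealDist d Y Z ≤ M :=
  (iInf₂_le p hp).trans (iSup₂_le fun q hq => formalBallDist_le_iff.2 (h q hq))

lemma exists_of_idealDist_lt {Y Z : zeroApertureIdeals d} {M : ℝ≥0∞} (h : idealDist d Y Z < M) :
    ∃ p ∈ Z.1, ∀ q ∈ Y.1, d q.1 p.1 + p.2 ≤ M + q.2 := by
  obtain ⟨p, hp⟩ := iInf_lt_iff.1 h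
  obtain ⟨hpZ, hp⟩ := iInf_lt_iff.1 hp
  exact ⟨p, hpZ, fun q hq => formalBallDist_le_iff.1
    ((le_iSup₂ (f := fun y (_ : y ∈ Y.1) => formalBallDist d y p) q hq).trans hp.le)⟩

lemma exists_of_idealDist_ne_top {Y Z : zeroApertureIdeals d} (h : idealDist d Y Z ≠ ⊤)
    {ε : ℝ≥0} (hε : 0 < ε) :
    ∃ p ∈ Z.1, ∀ q ∈ Y.1, d q.1 p.1 + p.2 ≤ idealDist d Y Z + ε + q.2 :=
  exists_of_idealDist_lt (ENNReal.lt_add_right h (by exact_mod_cast hε.ne'))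

lemma isDistance_idealDist (hd : IsDistance d) : IsDistance (idealDist d) := by
  intro Y Z W
  refine ENNReal.le_of_forall_pos_le_add fun ε hε htop => ?_
  obtain ⟨h₁, h₂⟩ := ENNReal.add_lt_top.1 htop
  obtain ⟨w, hw, hYw⟩ := exists_of_idealDist_ne_top h₁.ne (half_pos hε)
  obtain ⟨z, hz, hWz⟩ := exists_of_idealDist_ne_top h₂.ne (half_pos hε)
  refine idealDist_le hz fun y hy => ?_
  have h₃ := isDistance_formalBallDist hd y z w
  have h₄ := formalBallDist_le_iff.2 (hYw y hy)
  have h₅ := formalBallDist_le_iff.2 (hWz w hw)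
  rw [← formalBallDist_le_iff]
  calc formalBallDist d y z ≤ formalBallDist d y w + formalBallDist d w z := h₃
    _ ≤ (idealDist d Y W + (ε / 2 : ℝ≥0)) + (idealDist d W Z + (ε / 2 : ℝ≥0)) := by gcongr
    _ = idealDist d Y W + idealDist d W Z + ((ε / 2 : ℝ≥0) + (ε / 2 : ℝ≥0)) := by ring
    _ = _ := by rw [coe_half_add_half]

end Ideals

/-! ### Completeness of the space of ideals. -/

section Completeness

variable {X : Type u} {d : X → X → ℝ≥0∞}

lemma exists_of_idealDist_le (hd : IsDistance d) {Y Z : zeroApertureIdeals d} {ε δ : ℝ≥0}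
    (h : idealDist d Y Z ≤ ε) (hεδ : ε < δ) :
    ∃ p ∈ Z.1, p.2 ≤ δ ∧ ∀ q ∈ Y.1, d q.1 p.1 + p.2 ≤ δ + q.2 := by
  obtain ⟨p, hp, hle⟩ := exists_of_idealDist_lt (h.trans_lt (ENNReal.coe_lt_coe.2 hεδ))
  refine ⟨p, hp, ?_, hle⟩
  refine le_of_forall_pos_le_add fun η hη => ?_
  obtain ⟨q, hq, hqη, -⟩ := exists_mem_ideal_le hd Y ∅ (by simp) hη
  have : (p.2 : ℝ≥0∞) ≤ ((δ + η : ℝ≥0) : ℝ≥0∞) := calc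
    (p.2 : ℝ≥0∞) ≤ d q.1 p.1 + p.2 := le_add_self
    _ ≤ δ + q.2 := hle q hq
    _ ≤ ((δ + η : ℝ≥0) : ℝ≥0∞) := by push_cast; gcongr
  exact_mod_cast this

/-- Closeness of ideals becomes inclusion after enlarging radii; `δ` exceeds `ε` because the infimum
need not be attained. -/
lemma mem_of_idealDist_le (hd : IsDistance d) {Y Z : zeroApertureIdeals d} {ε δ : ℝ≥0}
    (h : idealDist d Y Z ≤ ε) (hεδ : ε < δ) {b : X} {t : ℝ≥0} (hb : (b, t) ∈ Y.1) :
    (b, t + δ) ∈ Z.1 := by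
  obtain ⟨p, hp, -, hle⟩ := exists_of_idealDist_le hd h hεδ
  refine mem_ideal_of_le hd Z hp ((hle _ hb).trans ?_)
  push_cast
  rw [add_comm]

/-- The closed lower limit of a net of sets of formal balls. -/
def lowerLimit {Λ : Type u} (prec : Λ → Λ → Prop) (Y : Λ → Set (X × ℝ≥0)) : Set (X × ℝ≥0) :=
  {p | ∀ ε : ℝ≥0, 0 < ε → ∀ᶠ a in tails prec, (p.1, p.2 + ε) ∈ Y a}

variable {Λ : Type u} {prec : Λ → Λ → Prop} {Y : Λ → zeroApertureIdeals d}

lemma mem_lowerLimit_of_idealDist_le (hd : IsDistance d) (hΛ : IsNetOrder prec) {a : Λ}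
    {ε δ : ℝ≥0} (h : ∀ b, prec a b → idealDist d (Y a) (Y b) ≤ ε) (hεδ : ε < δ) {p : X × ℝ≥0}
    (hp : p ∈ (Y a).1) : (p.1, p.2 + δ) ∈ lowerLimit prec (fun a => (Y a).1) := by
  intro η _
  filter_upwards [hΛ.eventually_prec a] with b hb
  exact mem_ideal_mono hd _ (mem_of_idealDist_le hd (h b hb) hεδ hp) le_self_add

lemma lowerLimit_mem_zeroApertureIdeals (hd : IsDistance d) (hΛ : IsNetOrder prec)
    (hY : IsCauchyNet (idealDist d) prec Y) :
    lowerLimit prec (fun a => (Y a).1) ∈ zeroApertureIdeals d := by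
  have := hΛ.neBot
  refine (mem_zeroApertureIdeals_iff hd).2 ⟨fun F hF ε hε => ?_, fun b t h => ?_, fun ε hε => ?_⟩
  · classical
    -- One `η` enlarges the radii of `F` to enter `Y a`, one is spent on directedness there, and two
    -- on returning to the lower limit.
    obtain ⟨η, hη, h4⟩ : ∃ η : ℝ≥0, 0 < η ∧ 4 * η = ε :=
      ⟨ε / 4, by positivity, mul_div_cancel₀ _ (by norm_num)⟩
    have hev : ∀ᶠ a in tails prec, ∀ z ∈ F, (z.1, z.2 + η) ∈ (Y a).1 :=
      (Filter.eventually_all_finset F).2 fun z hz => hF hz η hη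
    obtain ⟨a, ha, hFa⟩ := ((isCauchyNet_iff.1 hY η hη).and hev).exists
    obtain ⟨y, hy, -, hle⟩ := exists_mem_ideal_le hd (Y a)
      (F.image fun z => (z.1, z.2 + η)) (by
        intro w hw
        obtain ⟨z, hz, rfl⟩ := Finset.mem_image.1 (Finset.mem_coe.1 hw)
        exact hFa z hz) hη
    refine ⟨_, mem_lowerLimit_of_idealDist_le hd hΛ ha
      (lt_add_of_pos_right η hη) hy, fun z hz => ?_⟩
    have := hle _ (Finset.mem_image_of_mem _ hz)
    calc d z.1 y.1 + ((y.2 + (η + η) : ℝ≥0) : ℝ≥0∞)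
        = (d z.1 y.1 + y.2) + (η + η) := by push_cast; ring
      _ ≤ (η + (z.2 + η : ℝ≥0)) + (η + η) := add_le_add_left this _
      _ = ((4 * η : ℝ≥0) : ℝ≥0∞) + z.2 := by push_cast; ring
      _ = ε + z.2 := by rw [h4]
  · intro ε hε
    obtain ⟨z, hz, hle⟩ := h (ε / 2) (half_pos hε)
    filter_upwards [hz (ε / 2) (half_pos hε)] with a ha
    refine mem_ideal_of_le hd _ ha ?_
    calc d b z.1 + ((z.2 + ε / 2 : ℝ≥0) : ℝ≥0∞) = (d b z.1 + z.2) + (ε / 2 : ℝ≥0) := by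
          push_cast; ring
      _ ≤ ((ε / 2 : ℝ≥0) + t) + (ε / 2 : ℝ≥0) := add_le_add_left hle _
      _ = ((ε / 2 : ℝ≥0) : ℝ≥0∞) + (ε / 2 : ℝ≥0) + t := by ring
      _ = ((t + ε : ℝ≥0) : ℝ≥0∞) := by rw [coe_half_add_half]; push_cast; ring
  · obtain ⟨η, hη, h3⟩ : ∃ η : ℝ≥0, 0 < η ∧ 3 * η = ε :=
      ⟨ε / 3, by positivity, mul_div_cancel₀ _ (by norm_num)⟩
    obtain ⟨a, ha⟩ := (isCauchyNet_iff.1 hY η hη).exists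
    obtain ⟨y, hy, hyη, -⟩ := exists_mem_ideal_le hd (Y a) ∅ (by simp) hη
    refine ⟨_, mem_lowerLimit_of_idealDist_le hd hΛ ha (lt_add_of_pos_right η hη) hy, ?_⟩
    calc y.2 + (η + η) ≤ η + (η + η) := by gcongr
      _ = 3 * η := by ring
      _ = ε := h3

theorem isSmythComplete_idealDist (hd : IsDistance d) : IsSmythComplete (idealDist d) := by
  intro Λ prec Y hΛ hY
  have := hΛ.neBot
  refine ⟨⟨_, lowerLimit_mem_zeroApertureIdeals hd hΛ hY⟩,
    smythConverges_of_le (isDistance_idealDist hd) (fun ε hε => ?_) fun W ε hε => ?_⟩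
  · obtain ⟨η, hη, h4⟩ : ∃ η : ℝ≥0, 0 < η ∧ 4 * η = ε :=
      ⟨ε / 4, by positivity, mul_div_cancel₀ _ (by norm_num)⟩
    have hlt : η < η + η := lt_add_of_pos_right η hη
    filter_upwards [isCauchyNet_iff.1 hY η hη] with a ha
    -- A single ball must bound all of `Y a`; a later `Y b` contains one, and enlarging its radius
    -- puts it in the lower limit.
    obtain ⟨b, hb, hab⟩ := ((isCauchyNet_iff.1 hY η hη).and (hΛ.eventually_prec a)).exists
    obtain ⟨p, hp, -, hle⟩ := exists_of_idealDist_le hd (ha b hab) hlt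
    refine idealDist_le (mem_lowerLimit_of_idealDist_le hd hΛ hb hlt hp) fun q hq => ?_
    calc d q.1 p.1 + ((p.2 + (η + η) : ℝ≥0) : ℝ≥0∞)
        = (d q.1 p.1 + p.2) + (η + η) := by push_cast; ring
      _ ≤ ((η + η : ℝ≥0) + q.2) + (η + η) := add_le_add_left (hle q hq) _
      _ = ((4 * η : ℝ≥0) : ℝ≥0∞) + q.2 := by push_cast; ring
      _ = ε + q.2 := by rw [h4]
  · set Z : zeroApertureIdeals d := ⟨_, lowerLimit_mem_zeroApertureIdeals hd hΛ hY⟩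
    rcases eq_or_ne (idealDist d W Z) ⊤ with htop | htop
    · simp [htop]
    obtain ⟨p, hp, hle⟩ := exists_of_idealDist_ne_top htop (half_pos hε)
    filter_upwards [hp (ε / 2) (half_pos hε)] with a ha
    refine idealDist_le ha fun q hq => ?_
    calc d q.1 p.1 + ((p.2 + ε / 2 : ℝ≥0) : ℝ≥0∞) = (d q.1 p.1 + p.2) + (ε / 2 : ℝ≥0) := by
          push_cast; ring
      _ ≤ (idealDist d W Z + (ε / 2 : ℝ≥0) + q.2) + (ε / 2 : ℝ≥0) := add_le_add_left (hle q hq) _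
      _ = idealDist d W Z + (((ε / 2 : ℝ≥0) : ℝ≥0∞) + (ε / 2 : ℝ≥0)) + q.2 := by ring
      _ = _ := by rw [coe_half_add_half]

end Completeness

/-! ### Points as ideals, and the universal property. -/

section DenseIsometry

/-- An isometry `j` of `a` into a distance `d` with `d̄ ≤ d̲`, whose image is a Smyth basis. -/
structure IsDenseIsometry {A X : Type u} (a : A → A → ℝ≥0∞) (d : X → X → ℝ≥0∞) (j : A → X) :
    Prop where
  isDistance : IsDistance d
  upper_le_lower : ∀ x y, upperHemimetric d x y ≤ lowerHemimetric d x y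
  isometry : ∀ b c, d (j b) (j c) = a b c
  basis : IsSmythBasis d (range j)

/-- The formal balls of `A` at zero distance below `(x, 0)`. -/
def ballsBelow {A X : Type u} (d : X → X → ℝ≥0∞) (j : A → X) (x : X) : Set (A × ℝ≥0) :=
  {p | d (j p.1) x ≤ p.2}

lemma pointBallsIn_eq {X : Type u} (d : X → X → ℝ≥0∞) (B : Set X) (x : X) :
    pointBallsIn d B x = ballsBelow d ((↑) : B → X) x := by
  ext p
  change formalBallDist d _ _ = 0 ↔ d _ _ ≤ _
  rw [← nonpos_iff_eq_zero, formalBallDist_le_iff]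
  simp

variable {A X : Type u} {a : A → A → ℝ≥0∞} {d : X → X → ℝ≥0∞} {j : A → X}

namespace IsDenseIsometry

lemma isDistance_source (H : IsDenseIsometry a d j) : IsDistance a := fun b c e => by
  simpa only [H.isometry] using H.isDistance (j b) (j c) (j e)

lemma approx (H : IsDenseIsometry a d j) (x : X) (F : Finset X) {ε : ℝ≥0} (hε : 0 < ε) :
    ∃ b, d (j b) x ≤ ε ∧ ∀ c ∈ F, d c (j b) ≤ d c x + ε := by
  obtain ⟨_, ⟨b, rfl⟩, h⟩ := H.basis.approx x F hε
  exact ⟨b, h⟩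

lemma ballsBelow_mem (H : IsDenseIsometry a d j) (x : X) :
    ballsBelow d j x ∈ zeroApertureIdeals a := by
  refine (mem_zeroApertureIdeals_iff H.isDistance_source).2
    ⟨fun F hF ε hε => ?_, fun b t h => ?_, fun ε hε => ?_⟩
  · classical
    obtain ⟨b, hbx, hb⟩ := H.approx x (F.image fun z => j z.1) (half_pos hε)
    refine ⟨(b, ε / 2), hbx, fun z hz => ?_⟩
    have h₁ := hb _ (Finset.mem_image_of_mem _ hz)
    have h₂ : d (j z.1) x ≤ z.2 := hF hz
    calc a z.1 b + (ε / 2 : ℝ≥0) = d (j z.1) (j b) + (ε / 2 : ℝ≥0) := by rw [H.isometry]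
      _ ≤ (z.2 + (ε / 2 : ℝ≥0)) + (ε / 2 : ℝ≥0) := by gcongr; exact h₁.trans (by gcongr)
      _ = (((ε / 2 : ℝ≥0) : ℝ≥0∞) + (ε / 2 : ℝ≥0)) + z.2 := by ring
      _ = _ := by rw [coe_half_add_half]
  · change d (j b) x ≤ t
    refine ENNReal.le_of_forall_pos_le_add fun ε hε _ => ?_
    obtain ⟨y, hy, hle⟩ := h ε hε
    calc d (j b) x ≤ d (j b) (j y.1) + d (j y.1) x := H.isDistance _ _ _
      _ ≤ a b y.1 + y.2 := by rw [H.isometry]; exact add_le_add_right hy _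
      _ ≤ ε + t := hle
      _ = _ := add_comm _ _
  · obtain ⟨b, hb, -⟩ := H.approx x ∅ hε
    exact ⟨(b, ε), hb, le_rfl⟩

/-- The ideal of formal balls below a point. -/
def toIdeal (H : IsDenseIsometry a d j) (x : X) : zeroApertureIdeals a :=
  ⟨ballsBelow d j x, H.ballsBelow_mem x⟩

lemma mem_toIdeal (H : IsDenseIsometry a d j) {x : X} {p : A × ℝ≥0} :
    p ∈ (H.toIdeal x).1 ↔ d (j p.1) x ≤ p.2 :=
  Iff.rfl

/-- A bound on the distances of formal balls below `x` to `(c, s)` bounds the distances from `x`.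
This is where `d̄ ≤ d̲` is used. -/
lemma dist_add_le_of_forall (H : IsDenseIsometry a d j) {x : X} {c : A} {s : ℝ≥0} {M : ℝ≥0∞}
    (h : ∀ p ∈ (H.toIdeal x).1, a p.1 c + s ≤ M + p.2) (z : X) :
    d x z + s ≤ M + d (j c) z := by
  -- Balls below `x` have arbitrarily small radii. The bound makes the truncated `M - s` an exact
  -- difference.
  have hs : (s : ℝ≥0∞) ≤ M := by
    refine ENNReal.le_of_forall_pos_le_add fun ε hε _ => ?_
    obtain ⟨b, hb, -⟩ := H.approx x ∅ hε
    exact le_add_self.trans (h (b, ε) hb)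
  have hl : lowerHemimetric d x (j c) ≤ M - s := by
    refine iSup_le fun w => ?_
    rw [tsub_le_iff_right]
    refine ENNReal.le_of_add_le_add_right (ENNReal.coe_ne_top (r := s)) ?_
    refine ENNReal.le_of_forall_pos_le_add fun ε hε _ => ?_
    obtain ⟨b, hb, hw⟩ := H.approx x {w} (half_pos hε)
    calc d w (j c) + s ≤ (d w (j b) + d (j b) (j c)) + s := by gcongr; exact H.isDistance _ _ _
      _ = d w (j b) + (a b c + s) := by rw [H.isometry]; ring
      _ ≤ (d w x + (ε / 2 : ℝ≥0)) + (M + (ε / 2 : ℝ≥0)) := by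
        exact add_le_add (hw w (by simp)) (h (b, ε / 2) hb)
      _ = M + d w x + (((ε / 2 : ℝ≥0) : ℝ≥0∞) + (ε / 2 : ℝ≥0)) := by ring
      _ = (M - s + s) + d w x + ε := by rw [coe_half_add_half, tsub_add_cancel_of_le hs]
      _ = _ := by ring
  calc d x z + s ≤ (upperHemimetric d x (j c) + d (j c) z) + s := by
        gcongr; exact dist_le_upperHemimetric_add _ _ _
    _ ≤ ((M - s) + d (j c) z) + s := by gcongr; exact (H.upper_le_lower _ _).trans hl
    _ = (M - s + s) + d (j c) z := by ring
    _ = _ := by rw [tsub_add_cancel_of_le hs]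

/-- For `≤`, the witness is a small ball around a basis point `c` near `y` with `d x (j c)` almost
at most `d x y`. For `≥`, `dist_add_le_of_forall` is applied to a near-optimal ball below `y`, whose
radius cancels. -/
theorem idealDist_toIdeal (H : IsDenseIsometry a d j) (x y : X) :
    idealDist a (H.toIdeal x) (H.toIdeal y) = d x y := by
  refine le_antisymm ?_ ?_
  · refine ENNReal.le_of_forall_pos_le_add fun ε hε _ => ?_
    obtain ⟨c, hc, hx⟩ := H.approx y {x} (half_pos hε)
    refine idealDist_le (p := (c, ε / 2)) hc fun q hq => ?_
    calc a q.1 c + (ε / 2 : ℝ≥0) = d (j q.1) (j c) + (ε / 2 : ℝ≥0) := by rw [H.isometry]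
      _ ≤ (d (j q.1) x + d x (j c)) + (ε / 2 : ℝ≥0) := by gcongr; exact H.isDistance _ _ _
      _ ≤ (q.2 + (d x y + (ε / 2 : ℝ≥0))) + (ε / 2 : ℝ≥0) := by
        gcongr
        exacts [hq, hx x (by simp)]
      _ = d x y + (((ε / 2 : ℝ≥0) : ℝ≥0∞) + (ε / 2 : ℝ≥0)) + q.2 := by ring
      _ = _ := by rw [coe_half_add_half]
  · refine le_of_forall_gt fun M hM => ?_
    obtain ⟨M', hM', hlt⟩ := exists_between hM
    obtain ⟨p, hp, hle⟩ := exists_of_idealDist_lt hM'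
    refine lt_of_le_of_lt ?_ hlt
    refine ENNReal.le_of_add_le_add_right (ENNReal.coe_ne_top (r := p.2)) ?_
    exact (H.dist_add_le_of_forall hle y).trans (add_le_add_right hp _)

lemma idealDist_toIdeal_le (H : IsDenseIsometry a d j) {Y : zeroApertureIdeals a} {p : A × ℝ≥0}
    (hp : p ∈ Y.1) : idealDist a (H.toIdeal (j p.1)) Y ≤ p.2 := by
  refine idealDist_le hp fun q hq => ?_
  rw [add_comm, ← H.isometry]
  exact add_le_add_right hq _

/-- Near-optimal witnesses in `Y` for the finitely many `W` have an upper bound `y ∈ Y`. They lie,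
slightly enlarged, below `j y.1`, so its ideal approximates `Y`. -/
theorem isSmythBasis_idealDist (H : IsDenseIsometry a d j) :
    IsSmythBasis (idealDist a) (range fun b => H.toIdeal (j b)) := by
  classical
  have ha := H.isDistance_source
  refine IsSmythBasis.of_approx (isDistance_idealDist ha) fun Y F ε hε => ?_
  obtain ⟨η, hη, h3⟩ : ∃ η : ℝ≥0, 0 < η ∧ 3 * η = ε :=
    ⟨ε / 3, by positivity, mul_div_cancel₀ _ (by norm_num)⟩
  have hηε : η ≤ ε := by
    rw [← h3]
    exact le_mul_of_one_le_left (zero_le) (by norm_num)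
  have hW : ∀ W : zeroApertureIdeals a, ∃ p ∈ Y.1, idealDist a W Y ≠ ⊤ →
      ∀ q ∈ W.1, a q.1 p.1 + p.2 ≤ idealDist a W Y + η + q.2 := by
    intro W
    rcases eq_or_ne (idealDist a W Y) ⊤ with h | h
    · obtain ⟨p, hp, -⟩ := exists_mem_ideal_le ha Y ∅ (by simp) hη
      exact ⟨p, hp, fun h' => absurd h h'⟩
    · obtain ⟨p, hp, hle⟩ := exists_of_idealDist_ne_top h hη
      exact ⟨p, hp, fun _ => hle⟩
  choose p hp hle using hW
  obtain ⟨y, hy, hyη, hyF⟩ := exists_mem_ideal_le ha Y (F.image p) (by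
    intro w hw
    obtain ⟨W, -, rfl⟩ := Finset.mem_image.1 (Finset.mem_coe.1 hw)
    exact hp W) hη
  refine ⟨_, ⟨y.1, rfl⟩, (H.idealDist_toIdeal_le hy).trans ?_, fun W hWF => ?_⟩
  · exact_mod_cast hyη.trans hηε
  · rcases eq_or_ne (idealDist a W Y) ⊤ with h | h
    · simp [h]
    have hmem : ((p W).1, (p W).2 + η) ∈ (H.toIdeal (j y.1)).1 := by
      rw [mem_toIdeal, H.isometry]
      refine le_self_add.trans ((hyF _ (Finset.mem_image_of_mem _ hWF)).trans ?_)
      push_cast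
      rw [add_comm]
    refine idealDist_le hmem fun q hq => ?_
    calc a q.1 (p W).1 + (((p W).2 + η : ℝ≥0) : ℝ≥0∞)
        = (a q.1 (p W).1 + (p W).2) + η := by push_cast; ring
      _ ≤ (idealDist a W Y + η + q.2) + η := add_le_add_left (hle W h q hq) _
      _ = idealDist a W Y + (η + η : ℝ≥0) + q.2 := by push_cast; ring
      _ ≤ idealDist a W Y + ε + q.2 := by
        gcongr
        rw [← h3, ← two_mul]
        gcongr
        norm_num

/-- For a ball `q ∈ Y`, the ideal of its centre is within `q.2` of `Y`, hence within `M + q.2` of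
`Z`. `dist_add_le_of_forall` turns this into a bound on distances out of `q.1`; the ball `z` depends
on `q`, but its radius cancels. -/
lemma upper_le_lower_idealDist (H : IsDenseIsometry a d j) (Y Z : zeroApertureIdeals a) :
    upperHemimetric (idealDist a) Y Z ≤ lowerHemimetric (idealDist a) Y Z := by
  refine iSup_le fun W => tsub_le_iff_right.2 ?_
  set M := lowerHemimetric (idealDist a) Y Z
  refine ENNReal.le_of_forall_pos_le_add fun ε hε htop => ?_
  obtain ⟨hM, hZW⟩ := ENNReal.add_lt_top.1 htop
  obtain ⟨w, hw, hle⟩ := exists_of_idealDist_ne_top hZW.ne (half_pos hε)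
  refine idealDist_le hw fun q hq => ?_
  have h₁ : idealDist a (H.toIdeal (j q.1)) Z ≤ M + q.2 :=
    (dist_le_add_lowerHemimetric _ _ Y).trans
      (add_le_add_right (H.idealDist_toIdeal_le hq) _)
  have hlt : idealDist a (H.toIdeal (j q.1)) Z < M + q.2 + (ε / 2 : ℝ≥0) :=
    h₁.trans_lt (ENNReal.lt_add_right (by simp [hM.ne]) (by
      exact_mod_cast (half_pos hε).ne'))
  obtain ⟨z, hz, hzle⟩ := exists_of_idealDist_lt hlt
  have h₂ := H.dist_add_le_of_forall hzle (j w.1)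
  rw [H.isometry, H.isometry] at h₂
  refine ENNReal.le_of_add_le_add_right (ENNReal.coe_ne_top (r := z.2)) ?_
  calc a q.1 w.1 + w.2 + z.2 = (a q.1 w.1 + z.2) + w.2 := by ring
    _ ≤ (M + q.2 + (ε / 2 : ℝ≥0) + a z.1 w.1) + w.2 := add_le_add_left h₂ _
    _ = (M + q.2 + (ε / 2 : ℝ≥0)) + (a z.1 w.1 + w.2) := by ring
    _ ≤ (M + q.2 + (ε / 2 : ℝ≥0)) + (idealDist a Z W + (ε / 2 : ℝ≥0) + z.2) :=
      add_le_add_right (hle z hz) _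
    _ = M + idealDist a Z W + (((ε / 2 : ℝ≥0) : ℝ≥0∞) + (ε / 2 : ℝ≥0)) + q.2 + z.2 := by ring
    _ = _ := by rw [coe_half_add_half]

theorem isSmythDomain_idealDist (H : IsDenseIsometry a d j) : IsSmythDomain (idealDist a) :=
  ⟨isSmythComplete_idealDist H.isDistance_source,
    H.isSmythBasis_idealDist.isSmythContinuous, H.upper_le_lower_idealDist⟩

lemma isSmythComplete_of_surjective (H : IsDenseIsometry a d j)
    (hsurj : Function.Surjective H.toIdeal) : IsSmythComplete d := by
  intro Λ prec x hΛ hx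
  have hc : IsCauchyNet (idealDist a) prec fun i => H.toIdeal (x i) := by
    simpa only [IsCauchyNet, H.idealDist_toIdeal] using hx
  obtain ⟨Y, hY⟩ := isSmythComplete_idealDist H.isDistance_source Λ prec _ hΛ hc
  obtain ⟨p, rfl⟩ := hsurj Y
  refine ⟨p, smythConverges_iff.2 fun c => ?_⟩
  simpa only [H.idealDist_toIdeal] using smythConverges_iff.1 hY (H.toIdeal c)

lemma surjective_of_isSmythComplete (H : IsDenseIsometry a d j) (hd : IsSmythComplete d) :
    Function.Surjective H.toIdeal := by
  classical
  intro Y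
  have ha := H.isDistance_source
  -- The threshold radius at `b`, attained when finite because ideals are closed.
  let φ : A → ℝ≥0∞ := fun b => ⨅ p ∈ Y.1, a b p.1 + p.2
  have hφ : ∀ b (t : ℝ≥0), (b, t) ∈ Y.1 ↔ φ b ≤ t := by
    intro b t
    constructor
    · intro hb
      refine ENNReal.le_of_forall_pos_le_add fun ε hε _ => ?_
      obtain ⟨y, hy, -, hle⟩ := exists_mem_ideal_le ha Y {(b, t)} (by simpa using hb) hε
      refine (iInf₂_le y hy).trans ((hle _ (Finset.mem_singleton_self _)).trans ?_)
      rw [add_comm]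
    · intro hb
      refine mem_ideal_of_forall ha Y fun ε hε => ?_
      have : φ b < ε + t := hb.trans_lt (by
        rw [add_comm]
        exact ENNReal.lt_add_right ENNReal.coe_ne_top (by exact_mod_cast hε.ne'))
      obtain ⟨y, hy⟩ := iInf_lt_iff.1 this
      obtain ⟨hyY, hy⟩ := iInf_lt_iff.1 hy
      exact ⟨y, hyY, hy.le⟩
  have hφtri : ∀ b c, φ b ≤ a b c + φ c := by
    intro b c
    simp only [φ, ENNReal.add_iInf]
    refine le_iInf₂ fun p hp => (iInf₂_le p hp).trans ?_
    rw [← add_assoc]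
    gcongr
    exact ha _ _ _
  obtain ⟨Λ, prec, x, hΛ, -, hx, h₀, h₁⟩ := exists_cauchyNet (d := a) univ φ (by
    intro F ε hε
    -- Points with `φ c = ⊤` impose no constraint; the others give balls `(c, φ c)` of `Y`.
    obtain ⟨y, hy, hyε, hle⟩ := exists_mem_ideal_le ha Y
      ((F.filter fun c => φ c ≠ ⊤).image fun c => (c, (φ c).toNNReal)) (by
        intro w hw
        obtain ⟨c, hc, rfl⟩ := Finset.mem_image.1 (Finset.mem_coe.1 hw)
        rw [hφ, ENNReal.coe_toNNReal (Finset.mem_filter.1 hc).2]) hε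
    refine ⟨y.1, mem_univ _, ((hφ y.1 y.2).1 hy).trans (by exact_mod_cast hyε), fun c hc => ?_⟩
    by_cases hctop : φ c = ⊤
    · simp [hctop]
    · have := hle _ (Finset.mem_image_of_mem _ (Finset.mem_filter.2 ⟨hc, hctop⟩))
      rw [ENNReal.coe_toNNReal hctop, add_comm (ε : ℝ≥0∞)] at this
      exact le_self_add.trans this)
  have := hΛ.neBot
  obtain ⟨p, hp⟩ := hd Λ prec (fun i => j (x i)) hΛ (by
    simpa only [IsCauchyNet, H.isometry] using hx)
  have hlim : ∀ b, d (j b) p = φ b := by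
    intro b
    refine tendsto_nhds_unique (smythConverges_iff.1 hp (j b)) ?_
    simp only [H.isometry]
    refine tendsto_of_forall_le_add (h₁ b) fun ε hε => ?_
    filter_upwards [h₀ ε hε] with i hi
    exact (hφtri b (x i)).trans (by gcongr)
  refine ⟨p, Subtype.ext (Set.ext fun q => ?_)⟩
  rw [mem_toIdeal, hlim]
  exact (hφ q.1 q.2).symm

lemma toIdeal_eq_toIdeal (H : IsDenseIsometry a d j) {X' : Type u} {d' : X' → X' → ℝ≥0∞}
    {j' : A → X'} (H' : IsDenseIsometry a d' j') {x : X} {x' : X'}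
    (h : ∀ b, d (j b) x = d' (j' b) x') : H.toIdeal x = H'.toIdeal x' := by
  refine Subtype.ext (Set.ext fun q => ?_)
  rw [mem_toIdeal, mem_toIdeal, h]

lemma distEquiv_of_toIdeal_eq (H : IsDenseIsometry a d j) {x y : X}
    (h : H.toIdeal x = H.toIdeal y) : DistEquiv d x y := fun z => by
  simp only [← H.idealDist_toIdeal, h, and_self]

/-- A dense isometry extends to any other dense isometry into a complete space. -/
lemma exists_extension (H : IsDenseIsometry a d j) {Y : Type u} {e : Y → Y → ℝ≥0∞} {k : A → Y}
    (K : IsDenseIsometry a e k) (he : IsSmythComplete e) :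
    ∃ f : X → Y, (∀ x y, e (f x) (f y) = d x y) ∧ (∀ b, DistEquiv e (f (j b)) (k b)) ∧
      (∀ g : X → Y, (∀ x y, e (g x) (g y) = d x y) → (∀ b, DistEquiv e (g (j b)) (k b)) →
        ∀ x, DistEquiv e (g x) (f x)) ∧
      (IsSmythComplete d → ∀ y, ∃ x, DistEquiv e (f x) y) := by
  choose f hf using fun x => K.surjective_of_isSmythComplete he (H.toIdeal x)
  refine ⟨f, fun x y => ?_, fun b => ?_, fun g hg hgk x => ?_, fun hd y => ?_⟩
  · rw [← K.idealDist_toIdeal, hf, hf, H.idealDist_toIdeal]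
  · refine K.distEquiv_of_toIdeal_eq ((hf (j b)).trans (H.toIdeal_eq_toIdeal K fun c => ?_))
    rw [H.isometry, K.isometry]
  · refine K.distEquiv_of_toIdeal_eq ((K.toIdeal_eq_toIdeal H fun c => ?_).trans (hf x).symm)
    -- `e (k c) (g x) = e (g (j c)) (g x) = d (j c) x`, so `g x` and `x` have the same ideal.
    rw [← (hgk c (g x)).1, hg]
  · obtain ⟨x, hx⟩ := H.surjective_of_isSmythComplete hd (K.toIdeal y)
    exact ⟨x, K.distEquiv_of_toIdeal_eq ((hf x).trans hx)⟩

end IsDenseIsometry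

end DenseIsometry

end SmythDomains

open SmythDomains in
theorem mainTheorem12 {X : Type u} (d : X → X → ℝ≥0∞) (hd : IsDistance d)
    (hX : IsSmythPredomain d) (B : Set X) (hB : IsSmythBasis d B) :
    ∃ h : ∀ x, pointBallsIn d B x ∈ zeroApertureIdeals (restrictDist d B),
      -- the zero-aperture ideals of `B` form a Smyth domain
      (IsDistance (idealDist (restrictDist d B)) ∧ IsSmythDomain (idealDist (restrictDist d B))) ∧
      -- the map is an isometry
      (∀ x y, idealDist (restrictDist d B) ⟨pointBallsIn d B x, h x⟩ ⟨pointBallsIn d B y, h y⟩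
        = d x y) ∧
      -- it is onto exactly when `X` is a Smyth domain
      (Function.Surjective
          (fun x => (⟨pointBallsIn d B x, h x⟩ : zeroApertureIdeals (restrictDist d B))) ↔
        IsSmythDomain d) ∧
      -- uniqueness of the Smyth completion, up to isometry and equivalence of points
      (∀ (Y : Type u) (e : Y → Y → ℝ≥0∞) (j : B → Y), IsDistance e → IsSmythDomain e →
        (∀ b c : B, e (j b) (j c) = d b c) → IsSmythBasis e (Set.range j) →
        ∃ f : X → Y, (∀ x y, e (f x) (f y) = d x y) ∧ (∀ b : B, DistEquiv e (f b) (j b)) ∧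
          (∀ g : X → Y, (∀ x y, e (g x) (g y) = d x y) → (∀ b : B, DistEquiv e (g b) (j b)) →
            ∀ x, DistEquiv e (g x) (f x)) ∧
          (IsSmythDomain d → ∀ y, ∃ x, DistEquiv e (f x) y)) := by

  have H : IsDenseIsometry (restrictDist d B) d ((↑) : B → X) :=
    ⟨hd, hX.2, fun _ _ => rfl, by rwa [Subtype.range_coe]⟩
  have h : ∀ x, pointBallsIn d B x ∈ zeroApertureIdeals (restrictDist d B) := fun x => by
    rw [pointBallsIn_eq]
    exact H.ballsBelow_mem x
  have heq : ∀ x, (⟨pointBallsIn d B x, h x⟩ : zeroApertureIdeals (restrictDist d B)) =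
      H.toIdeal x := fun x => Subtype.ext (pointBallsIn_eq d B x)
  refine ⟨h, ⟨isDistance_idealDist H.isDistance_source, H.isSmythDomain_idealDist⟩,
    fun x y => ?_, ?_, fun Y e j he heD hj hjB => ?_⟩
  · rw [heq, heq, H.idealDist_toIdeal]
  · simp only [heq]
    exact ⟨fun hs => ⟨H.isSmythComplete_of_surjective hs, hX⟩,
      fun hD => H.surjective_of_isSmythComplete hD.1⟩
  · obtain ⟨f, h₁, h₂, h₃, h₄⟩ := H.exists_extension ⟨he, heD.2.2, hj, hjB⟩ heD.1
    exact ⟨f, h₁, h₂, h₃, fun hD => h₄ hD.1⟩
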